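/- Let $n_1,k_1,n_2,k_2$ be integers with $1\le k_1\le n_1$ and $1\le k_2\le n_2$, and let $\mu_1,\mu_2>0$. Let $T_{i,j}$ ($1\le i\le n_2$, $1\le j\le n_1$) be exponential random variables with rate $\mu_1$ and $T^{(c)}_i$ ($1\le i\le n_2$) exponential random variables with rate $\mu_2$, all of them mutually independent. Let $T_{(m)}$ denote the $m$-th smallest of the $n_1n_2$ variables $T_{i,j}$, and put $$\mathcal L:=\mathbb E\Big[\,k_2^{\text{th}}\!\min_{1\le i\le n_2}\big(T^{(c)}_i+T_{(ik_1)}\big)\Big],$$ where $k^{\text{th}}\min$ denotes the $k$-th smallest value of a finite family, counted with multiplicity. Let $\mathbb C$ be the (right-continuous) continuous-time Markov chain on the state space $\{0,1,\dots,n_2k_1\}\times\{0,1,\dots,k_2\}$, started at $(0,0)$, with the following transition rates (all others being zero): - from $(u,v)$ to $(u+1,v)$ at rate $(n_1n_2-u)\mu_1$, if $vk_1\le u<n_2k_1$; - from $(u,v)$ to $(u,v+1)$ at rate $(\lfloor u/k_1\rfloor-v)\mu_2$, if $0\le v<\min\{\lfloor u/k_1\rfloor,k_2\}$. Then $\mathcal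 L$ is finite, and the expected hitting time of $\mathbb C$ from state $(0,0)$ to the set of states $\{(u,k_2): k_2k_1\le u\le n_2k_1\}$ is equal to $\mathcal L$. -/

import Mathlib

open MeasureTheory ProbabilityTheory Filter Topology
open scoped NNReal ENNReal

noncomputable section

namespace HierCoding

/-- The `k`-th smallest value (counted with multiplicity, `1 ≤ k ≤ card ι`) of a finite family of
reals: the least real `t` such that at least `k` of the values are `≤ t`. -/
def kthMin {ι : Type*} [Fintype ι] (k : ℕ) (f : ι → ℝ) : ℝ :=
  sInf {t : ℝ | k ≤ (Finset.univ.filter fun i => f i ≤ t).card}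

/-- The generator (`Q`-matrix) of a finite-state continuous-time Markov chain with transition
rates `r x y` for `x ≠ y`: its rows sum to zero. -/
def generator {S : Type*} [Fintype S] [DecidableEq S] (r : S → S → ℝ) : Matrix S S ℝ :=
  Matrix.of fun x y => if x = y then -∑ z ∈ Finset.univ.erase x, r x z else r x y

/-- `X` is, under `P`, a (right-continuous) continuous-time Markov chain on the finite set `S`
with generator `Q`, started at `x₀`: given the states at times `t 0 ≤ ⋯ ≤ t n`, the probability of
being in `y` at time `t (n + 1) ≥ t n` is the `(x n, y)` entry of `exp ((t (n + 1) - t n) Q)`. -/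
structure IsContinuousTimeMarkovChain {S Ω : Type*} [Fintype S] [DecidableEq S]
    [MeasurableSpace Ω] (Q : Matrix S S ℝ) (x₀ : S) (X : ℝ≥0 → Ω → S) (P : Measure Ω) : Prop where
  measurableSet_eq : ∀ (t : ℝ≥0) (x : S), MeasurableSet {ω | X t ω = x}
  rightContinuous : ∀ (ω : Ω) (t : ℝ≥0), ∀ᶠ s in 𝓝[≥] t, X s ω = X t ω
  initial : ∀ᵐ ω ∂P, X 0 ω = x₀
  markov : ∀ (n : ℕ) (t : ℕ → ℝ≥0) (x : ℕ → S), Monotone t →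
    P.real {ω | ∀ i ≤ n + 1, X (t i) ω = x i} =
      P.real {ω | ∀ i ≤ n, X (t i) ω = x i} *
        NormedSpace.exp (((t (n + 1) : ℝ) - (t n : ℝ)) • Q) (x n) (x (n + 1))

/-- First time (in `[0, ∞]`) at which the process `X` is in `A`; it is `∞` if this never occurs. -/
def hittingTime {S Ω : Type*} (X : ℝ≥0 → Ω → S) (A : Set S) : Ω → ℝ≥0∞ :=
  hittingAfter X A 0

/-- The state space `{0, …, n₂ k₁} × {0, …, k₂}`. -/
abbrev State (n₂ k₁ k₂ : ℕ) : Type := Fin (n₂ * k₁ + 1) × Fin (k₂ + 1)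

/-- The transition rates of the auxiliary chain, from `(u, v) = s` to `s'`. -/
def rate (n₁ n₂ k₁ k₂ : ℕ) (μ₁ μ₂ : ℝ) (s s' : State n₂ k₁ k₂) : ℝ :=
  let u : ℕ := s.1
  let v : ℕ := s.2
  if (s'.1 : ℕ) = u + 1 ∧ (s'.2 : ℕ) = v ∧ v * k₁ ≤ u ∧ u < n₂ * k₁ then
    ((n₁ : ℝ) * n₂ - u) * μ₁
  else if (s'.1 : ℕ) = u ∧ (s'.2 : ℕ) = v + 1 ∧ v < min (u / k₁) k₂ then
    (((u / k₁ : ℕ) : ℝ) - v) * μ₂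
  else 0

/-- The target set `{(u, k₂) : k₂ k₁ ≤ u ≤ n₂ k₁}`. -/
def target (n₂ k₁ k₂ : ℕ) : Set (State n₂ k₁ k₂) :=
  {s | (s.2 : ℕ) = k₂ ∧ k₂ * k₁ ≤ (s.1 : ℕ)}

/-- The random variable `k₂-th min_{i ∈ [n₂]} (T_i^{(c)} + T_{(i k₁)})`, where `T_{(m)}` is the
`m`-th smallest of all the `T i j`. The index `i : Fin n₂` stands for `i + 1 ∈ [n₂]`. -/
def lowerBoundTime {n₁ n₂ : ℕ} (k₁ k₂ : ℕ) {Ω : Type*} (T : Fin n₂ → Fin n₁ → Ω → ℝ)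
    (Tc : Fin n₂ → Ω → ℝ) (ω : Ω) : ℝ :=
  kthMin k₂ fun i : Fin n₂ =>
    Tc i ω + kthMin (((i : ℕ) + 1) * k₁) fun p : Fin n₂ × Fin n₁ => T p.1 p.2 ω

end HierCoding

end

/-!
Consider the clocks of the first stage (rate `μ₁`) and those of the second stage (rate `μ₂`), where
the `i`-th clock of the second stage is started by the `i * k₁`-th ring in the first. When `u` and
`v` clocks have rung in the two stages, memorylessness makes the remaining times of the running
clocks fresh, so the next ring occurs after an exponential time whose rate is the total rate `Λ` of
the running clocks, and it is that of a given clock of rate `r` with probability `r / Λ`. Until then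
the latency decreases at unit speed. Hence its mean `h (u, v)` satisfies the first-step recursion
`Λ h = 1 + Λ₁ h (u + 1, v) + Λ₂ h (u, v + 1)`, where `Λ = Λ₁ + Λ₂` splits by stages.

As `Λ₁` and `Λ₂` are the rates of the chain, the same `h` satisfies `Q h = -1` off the target set,
and it vanishes on the target set. By Kolmogorov's forward equation `E h (X t)` has derivative
`-P (t < τ)`, where `τ` is the hitting time, and it tends to `0`; integrating gives
`E τ = h (0, 0)`.
-/

noncomputable section

namespace HierCoding

open scoped Matrix

section HittingTime

variable {S Ω : Type*} {X : ℝ≥0 → Ω → S} {A : Set S} {ω : Ω}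

lemma hittingTime_lt_iff {a : ℝ≥0∞} : hittingTime X A ω < a ↔ ∃ s : ℝ≥0, s < a ∧ X s ω ∈ A := by
  constructor
  · intro h
    obtain ⟨t, ht, hta⟩ := ENNReal.lt_iff_exists_nnreal_btwn.1 h
    obtain ⟨s, hs, hsA⟩ := (hittingAfter_lt_iff (u := X) (s := A) (n := 0) (i := t)).1 ht
    exact ⟨s, (ENNReal.coe_lt_coe.2 hs.2).trans hta, hsA⟩
  · rintro ⟨s, hsa, hsA⟩
    exact (hittingAfter_le_of_mem (u := X) (s := A) zero_le hsA).trans_lt hsa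

lemma hittingTime_lt_iff_of_dense (hX : ∀ t, ∀ᶠ s in 𝓝[≥] t, X s ω = X t ω) {D : Set ℝ≥0}
    (hD : Dense D) {a : ℝ≥0∞} :
    hittingTime X A ω < a ↔ ∃ q ∈ D, (q : ℝ≥0∞) < a ∧ X q ω ∈ A := by
  rw [hittingTime_lt_iff]
  refine ⟨?_, fun ⟨q, _, hqa, hqA⟩ => ⟨q, hqa, hqA⟩⟩
  rintro ⟨s, hsa, hsA⟩
  obtain ⟨t, hst, hta⟩ := ENNReal.lt_iff_exists_nnreal_btwn.1 hsa
  obtain ⟨u, hu, hconst⟩ :=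
    (mem_nhdsGE_iff_exists_Ico_subset' (ENNReal.coe_lt_coe.1 hst)).1 (hX s)
  obtain ⟨q, hqD, hsq, hqu⟩ := hD.exists_between (lt_min hu (ENNReal.coe_lt_coe.1 hst))
  have hq : X q ω = X s ω := hconst ⟨hsq.le, hqu.trans_le (min_le_left _ _)⟩
  exact ⟨q, hqD, (ENNReal.coe_lt_coe.2 (hqu.trans_le (min_le_right _ _))).trans hta, hq ▸ hsA⟩

lemma hittingTime_le_iff (hX : ∀ t, ∀ᶠ s in 𝓝[≥] t, X s ω = X t ω) {t : ℝ≥0} :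
    hittingTime X A ω ≤ t ↔ hittingTime X A ω < t ∨ X t ω ∈ A := by
  refine ⟨fun h => h.lt_or_eq.imp_right fun heq => ?_, ?_⟩
  · obtain ⟨u, htu, hconst⟩ := (mem_nhdsGE_iff_exists_Ico_subset' (lt_add_one t)).1 (hX t)
    obtain ⟨s, hsu, hsA⟩ := hittingTime_lt_iff.1 (heq.trans_lt (ENNReal.coe_lt_coe.2 htu))
    have hts : t ≤ s := ENNReal.coe_le_coe.1 <|
      heq ▸ hittingAfter_le_of_mem (u := X) (s := A) zero_le hsA
    have hs : X s ω = X t ω := hconst ⟨hts, ENNReal.coe_lt_coe.1 hsu⟩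
    exact hs ▸ hsA
  · rintro (h | h)
    · exact h.le
    · exact hittingAfter_le_of_mem (u := X) (s := A) zero_le h

lemma measurable_hittingTime [MeasurableSpace Ω] (hA : ∀ t, MeasurableSet {ω | X t ω ∈ A})
    (hX : ∀ ω t, ∀ᶠ s in 𝓝[≥] t, X s ω = X t ω) : Measurable (hittingTime X A) := by
  obtain ⟨D, hDc, hD⟩ := TopologicalSpace.exists_countable_dense ℝ≥0
  refine measurable_of_Iio fun a => ?_
  have h : hittingTime X A ⁻¹' Set.Iio a =
      ⋃ q ∈ D, ⋃ _ : (q : ℝ≥0∞) < a, {ω | X q ω ∈ A} := by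
    ext ω
    simp [hittingTime_lt_iff_of_dense (hX ω) hD, and_left_comm]
  rw [h]
  exact .biUnion hDc fun q _ => .iUnion fun _ => hA q

end HittingTime

lemma lintegral_eq_lintegral_meas_ofReal_lt {Ω : Type*} [MeasurableSpace Ω] {P : Measure Ω}
    [SFinite P] {τ : Ω → ℝ≥0∞} (hτ : Measurable τ) :
    ∫⁻ ω, τ ω ∂P = ∫⁻ t in Set.Ioi (0 : ℝ), P {ω | ENNReal.ofReal t < τ ω} := by
  have hvol (a : ℝ≥0∞) : volume ({t : ℝ | ENNReal.ofReal t < a} ∩ Set.Ioi 0) = a := by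
    obtain rfl | ha := eq_or_ne a ∞
    · simp
    · have h : {t : ℝ | ENNReal.ofReal t < a} ∩ Set.Ioi 0 = Set.Ioo 0 a.toReal := by
        ext t
        simp only [Set.mem_inter_iff, Set.mem_ofPred_eq, Set.mem_Ioi, Set.mem_Ioo]
        exact ⟨fun h => ⟨h.2, (ENNReal.ofReal_lt_iff_lt_toReal h.2.le ha).1 h.1⟩,
          fun h => ⟨(ENNReal.ofReal_lt_iff_lt_toReal h.1.le ha).2 h.2, h.1⟩⟩
      rw [h, Real.volume_Ioo, sub_zero, ENNReal.ofReal_toReal ha]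
  have hm : MeasurableSet {p : Ω × ℝ | ENNReal.ofReal p.2 < τ p.1} :=
    measurableSet_lt (by fun_prop) (by fun_prop)
  calc ∫⁻ ω, τ ω ∂P
      = (P.prod (volume.restrict (Set.Ioi 0))) {p | ENNReal.ofReal p.2 < τ p.1} := by
        rw [Measure.prod_apply hm]
        refine lintegral_congr fun ω => ?_
        rw [Measure.restrict_apply (measurable_prodMk_left hm)]
        exact (hvol (τ ω)).symm
    _ = ∫⁻ t in Set.Ioi (0 : ℝ), P {ω | ENNReal.ofReal t < τ ω} := Measure.prod_apply_symm hm

/-- If `φ' = -g` and `φ ≤ C g`, then `exp (t / C) φ` decreases, so `φ` decays exponentially. -/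
lemma tendsto_zero_of_hasDerivAt_neg_of_le_mul {φ g : ℝ → ℝ} {C : ℝ} (hC : 0 < C)
    (hderiv : ∀ t, 0 ≤ t → HasDerivAt φ (-g t) t) (hφ : ∀ t, 0 ≤ t → 0 ≤ φ t)
    (hle : ∀ t, 0 ≤ t → φ t ≤ C * g t) : Tendsto φ atTop (𝓝 0) := by
  have hψ (t : ℝ) (ht : 0 ≤ t) : HasDerivAt (fun t => Real.exp (t / C) * φ t)
      (Real.exp (t / C) * (1 / C) * φ t + Real.exp (t / C) * -g t) t :=
    (((hasDerivAt_id t).div_const C).exp).mul (hderiv t ht)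
  have hanti : AntitoneOn (fun t => Real.exp (t / C) * φ t) (Set.Ici 0) := by
    refine antitoneOn_of_hasDerivWithinAt_nonpos (convex_Ici 0)
      (fun t ht => (hψ t ht).continuousAt.continuousWithinAt)
      (fun t ht => (hψ t (interior_subset ht)).hasDerivWithinAt) fun t ht => ?_
    have h : φ t / C ≤ g t := (div_le_iff₀' hC).2 (hle t (interior_subset ht))
    calc _ = Real.exp (t / C) * (φ t / C - g t) := by ring
      _ ≤ 0 := mul_nonpos_of_nonneg_of_nonpos (Real.exp_nonneg _) (sub_nonpos.2 h)
  have hbound (t : ℝ) (ht : 0 ≤ t) : φ t ≤ φ 0 * Real.exp (-(t / C)) := by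
    have h := hanti Set.self_mem_Ici ht ht
    simp only [zero_div, Real.exp_zero, one_mul] at h
    rwa [Real.exp_neg, ← div_eq_mul_inv, le_div_iff₀' (Real.exp_pos _)]
  have hlim : Tendsto (fun t => φ 0 * Real.exp (-(t / C))) atTop (𝓝 0) := by
    simpa using (Real.tendsto_exp_neg_atTop_nhds_zero.comp
      (tendsto_id.atTop_div_const hC)).const_mul (φ 0)
  exact squeeze_zero' ((eventually_ge_atTop 0).mono hφ) ((eventually_ge_atTop 0).mono hbound) hlim

lemma lintegral_Ioi_of_hasDerivAt_neg {φ g : ℝ → ℝ}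
    (hderiv : ∀ t, 0 ≤ t → HasDerivAt φ (-g t) t) (hg : ∀ t, 0 ≤ t → 0 ≤ g t)
    (hlim : Tendsto φ atTop (𝓝 0)) :
    ∫⁻ t in Set.Ioi 0, ENNReal.ofReal (g t) = ENNReal.ofReal (φ 0) := by
  have hneg : ∀ t ∈ Set.Ioi 0, -g t ≤ 0 := fun t ht => neg_nonpos.2 (hg t (le_of_lt ht))
  have hint : IntegrableOn g (Set.Ioi 0) := by
    simpa using (integrableOn_Ioi_deriv_of_nonpos' hderiv hneg hlim).neg
  rw [← ofReal_integral_eq_lintegral_ofReal hint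
    ((ae_restrict_mem measurableSet_Ioi).mono fun t ht => hg t (le_of_lt ht))]
  congr 1
  simpa [integral_neg] using integral_Ioi_of_hasDerivAt_of_nonpos' hderiv hneg hlim

section MatrixExp

variable {S : Type*}

/-- `B` is a closed class for the generator `Q`: no transition of positive rate leaves `B`. -/
def IsClosedClass (Q : Matrix S S ℝ) (B : Set S) : Prop :=
  ∀ x ∈ B, ∀ y ∉ B, Q x y = 0

variable [Fintype S]

lemma IsClosedClass.mulVec_eq_zero {Q : Matrix S S ℝ} {B : Set S} (hB : IsClosedClass Q B)
    {f : S → ℝ} (hf : ∀ x ∈ B, f x = 0) {x : S} (hx : x ∈ B) : (Q *ᵥ f) x = 0 := by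
  refine Finset.sum_eq_zero fun y _ => ?_
  change Q x y * f y = 0
  by_cases hy : y ∈ B
  · rw [hf y hy, mul_zero]
  · rw [hB x hx y hy, zero_mul]

variable [DecidableEq S]

lemma IsClosedClass.exp_apply_eq_zero {Q : Matrix S S ℝ} {B : Set S} (hB : IsClosedClass Q B)
    (t : ℝ) {x y : S} (hx : x ∈ B) (hy : y ∉ B) : NormedSpace.exp (t • Q) x y = 0 := by
  classical
  have h : (t • Q).BlockTriangular (fun x => if x ∈ B then (1 : ℕ) else 0) := by
    intro x y hxy
    by_cases hx : x ∈ B <;> by_cases hy : y ∈ B <;> simp_all [hB x]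
  exact h.exp (by simp [hx, hy])

lemma IsClosedClass.exp_mulVec_congr {Q : Matrix S S ℝ} {B : Set S} (hB : IsClosedClass Q B)
    {f g : S → ℝ} (hfg : Set.EqOn f g B) (t : ℝ) {x : S} (hx : x ∈ B) :
    (NormedSpace.exp (t • Q) *ᵥ f) x = (NormedSpace.exp (t • Q) *ᵥ g) x := by
  refine Finset.sum_congr rfl fun y _ => ?_
  by_cases hy : y ∈ B
  · rw [hfg hy]
  · simp only [hB.exp_apply_eq_zero t hx hy, zero_mul]

open scoped Matrix.Norms.Operator in
lemma hasDerivAt_exp_smul_mulVec (Q : Matrix S S ℝ) (f : S → ℝ) (t : ℝ) :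
    HasDerivAt (fun s : ℝ => NormedSpace.exp (s • Q) *ᵥ f)
      (NormedSpace.exp (t • Q) *ᵥ (Q *ᵥ f)) t := by
  have h : HasDerivAt (fun s : ℝ => NormedSpace.exp (s • Q)) (NormedSpace.exp (t • Q) * Q) t :=
    hasDerivAt_exp_smul_const Q t
  let L : Matrix S S ℝ →L[ℝ] S → ℝ :=
    LinearMap.toContinuousLinearMap ((Matrix.mulVecBilin ℝ ℝ).flip f)
  rw [Matrix.mulVec_mulVec]
  exact L.hasFDerivAt.comp_hasDerivAt t h

lemma IsClosedClass.hasDerivAt_exp_smul_mulVec_apply {Q : Matrix S S ℝ} {A B : Set S}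
    (hA : IsClosedClass Q A) (hB : IsClosedClass Q B) {h : S → ℝ} (h_zero : ∀ x ∈ A, h x = 0)
    (h_eq : ∀ x ∈ B, x ∉ A → (Q *ᵥ h) x = -1) (t : ℝ) {x : S} (hx : x ∈ B) :
    HasDerivAt (fun t : ℝ => (NormedSpace.exp (t • Q) *ᵥ h) x)
      (-(NormedSpace.exp (t • Q) *ᵥ Aᶜ.indicator 1) x) t := by
  have hQh : Set.EqOn (Q *ᵥ h) (-Aᶜ.indicator 1) B := fun y hy => by
    by_cases hyA : y ∈ A
    · simp [hA.mulVec_eq_zero h_zero hyA, hyA]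
    · simp [h_eq y hy hyA, hyA]
  refine (hasDerivAt_pi.1 (hasDerivAt_exp_smul_mulVec Q h t) x).congr_deriv ?_
  rw [hB.exp_mulVec_congr hQh t hx, Matrix.mulVec_neg, Pi.neg_apply]

end MatrixExp

namespace IsContinuousTimeMarkovChain

variable {S Ω : Type*} [Fintype S] [DecidableEq S] [MeasurableSpace Ω] {Q : Matrix S S ℝ} {x₀ : S}
  {X : ℝ≥0 → Ω → S} {P : Measure Ω}

lemma measurableSet_mem (hX : IsContinuousTimeMarkovChain Q x₀ X P) (t : ℝ≥0) (A : Set S) :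
    MeasurableSet {ω | X t ω ∈ A} := by
  have h : {ω | X t ω ∈ A} = ⋃ y ∈ A, {ω | X t ω = y} := by ext; simp
  rw [h]
  exact .biUnion A.to_countable fun y _ => hX.measurableSet_eq t y

lemma measureReal_eq_and_eq (hX : IsContinuousTimeMarkovChain Q x₀ X P) {s t : ℝ≥0} (hst : s ≤ t)
    (x y : S) : P.real {ω | X s ω = x ∧ X t ω = y} =
      P.real {ω | X s ω = x} * NormedSpace.exp (((t : ℝ) - s) • Q) x y := by
  have hmono : Monotone (fun i : ℕ => if i = 0 then s else t) := by
    intro i j hij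
    by_cases hi : i = 0 <;> by_cases hj : j = 0 <;> simp_all
  simpa [Nat.le_one_iff_eq_zero_or_eq_one] using
    hX.markov 0 _ (fun i => if i = 0 then x else y) hmono

variable [IsProbabilityMeasure P]

lemma measureReal_eq (hX : IsContinuousTimeMarkovChain Q x₀ X P) (t : ℝ≥0) (y : S) :
    P.real {ω | X t ω = y} = NormedSpace.exp ((t : ℝ) • Q) x₀ y := by
  have h0 : P.real {ω | X 0 ω = x₀} = 1 := by
    rw [measureReal_def, (mem_ae_iff_prob_eq_one (hX.measurableSet_eq 0 x₀)).1 hX.initial,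
      ENNReal.toReal_one]
  have h1 : P.real {ω | X 0 ω = x₀ ∧ X t ω = y} = P.real {ω | X t ω = y} :=
    measureReal_congr <| hX.initial.mono fun ω hω => propext (and_iff_right hω)
  simpa [h0, h1] using hX.measureReal_eq_and_eq (zero_le (a := t)) x₀ y

lemma exp_apply_nonneg (hX : IsContinuousTimeMarkovChain Q x₀ X P) {t : ℝ} (ht : 0 ≤ t) (y : S) :
    0 ≤ NormedSpace.exp (t • Q) x₀ y :=
  hX.measureReal_eq ⟨t, ht⟩ y ▸ measureReal_nonneg

lemma measureReal_mem (hX : IsContinuousTimeMarkovChain Q x₀ X P) (t : ℝ≥0) (A : Set S) :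
    P.real {ω | X t ω ∈ A} = (NormedSpace.exp ((t : ℝ) • Q) *ᵥ A.indicator 1) x₀ := by
  classical
  have h : {ω | X t ω ∈ A} = ⋃ y ∈ A.toFinset, {ω | X t ω = y} := by ext; simp
  rw [h, measureReal_biUnion_finset
    (fun x _ y _ hxy => Set.disjoint_left.2 fun ω hx hy => hxy (hx.symm.trans hy))
    fun y _ => hX.measurableSet_eq t y]
  simp [hX.measureReal_eq, Matrix.mulVec, dotProduct, Set.indicator_apply, Finset.sum_ite,
    Set.filter_mem_univ_eq_toFinset]

lemma ae_mem_of_mem (hX : IsContinuousTimeMarkovChain Q x₀ X P) {A : Set S}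
    (hA : IsClosedClass Q A) {s t : ℝ≥0} (hst : s ≤ t) : ∀ᵐ ω ∂P, X s ω ∈ A → X t ω ∈ A := by
  have hnull (x : A) (y : ↥Aᶜ) : ∀ᵐ ω ∂P, ¬(X s ω = x ∧ X t ω = y) := by
    have h := hX.measureReal_eq_and_eq hst x y
    rw [hA.exp_apply_eq_zero _ x.2 y.2, mul_zero, measureReal_eq_zero_iff] at h
    exact measure_eq_zero_iff_ae_notMem.1 h
  filter_upwards [ae_all_iff.2 fun x => ae_all_iff.2 (hnull x)] with ω hω hs
  by_contra ht
  exact hω ⟨_, hs⟩ ⟨_, ht⟩ ⟨rfl, rfl⟩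

lemma ae_mem_of_hittingTime_le (hX : IsContinuousTimeMarkovChain Q x₀ X P) {A : Set S}
    (hA : IsClosedClass Q A) (t : ℝ≥0) : ∀ᵐ ω ∂P, hittingTime X A ω ≤ t → X t ω ∈ A := by
  obtain ⟨D, hDc, hD⟩ := TopologicalSpace.exists_countable_dense ℝ≥0
  have h : ∀ᵐ ω ∂P, ∀ q ∈ D, q ≤ t → X q ω ∈ A → X t ω ∈ A :=
    (ae_ball_iff hDc).2 fun q _ => eventually_imp_distrib_left.2 (hX.ae_mem_of_mem hA)
  filter_upwards [h] with ω hω hle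
  obtain hlt | hmem := (hittingTime_le_iff (hX.rightContinuous ω)).1 hle
  · obtain ⟨q, hqD, hqt, hqA⟩ :=
      (hittingTime_lt_iff_of_dense (hX.rightContinuous ω) hD).1 hlt
    exact hω q hqD (ENNReal.coe_le_coe.1 hqt.le) hqA
  · exact hmem

lemma measureReal_lt_hittingTime (hX : IsContinuousTimeMarkovChain Q x₀ X P) {A : Set S}
    (hA : IsClosedClass Q A) (t : ℝ≥0) :
    P.real {ω | t < hittingTime X A ω} =
      (NormedSpace.exp ((t : ℝ) • Q) *ᵥ Aᶜ.indicator 1) x₀ := by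
  rw [← hX.measureReal_mem]
  refine measureReal_congr ?_
  filter_upwards [hX.ae_mem_of_hittingTime_le hA t] with ω hω
  refine propext ⟨fun hlt hmem => hlt.not_ge ?_, fun hmem => not_le.1 fun hle => hmem (hω hle)⟩
  exact (hittingTime_le_iff (hX.rightContinuous ω)).2 (Or.inr hmem)

/-- By Kolmogorov's forward equation, `E h (X t)` decreases at rate `P (X t ∉ A)`. -/
theorem lintegral_hittingTime (hX : IsContinuousTimeMarkovChain Q x₀ X P) {A B : Set S}
    (hA : IsClosedClass Q A) (hB : IsClosedClass Q B) (hx₀ : x₀ ∈ B) {h : S → ℝ}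
    (h_nonneg : ∀ x, 0 ≤ h x) (h_zero : ∀ x ∈ A, h x = 0)
    (h_eq : ∀ x ∈ B, x ∉ A → (Q *ᵥ h) x = -1) :
    ∫⁻ ω, hittingTime X A ω ∂P = ENNReal.ofReal (h x₀) := by
  set p : ℝ → S → ℝ := fun t => NormedSpace.exp (t • Q) x₀
  set g : ℝ → ℝ := fun t => p t ⬝ᵥ Aᶜ.indicator 1
  set C : ℝ := 1 + ∑ x, h x
  have hp (t : ℝ) (ht : 0 ≤ t) : 0 ≤ p t := hX.exp_apply_nonneg ht
  have hg (t : ℝ) (ht : 0 ≤ t) : 0 ≤ g t :=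
    dotProduct_nonneg_of_nonneg (hp t ht) (Set.indicator_nonneg fun _ _ => zero_le_one)
  have hφ (t : ℝ) (ht : 0 ≤ t) : 0 ≤ p t ⬝ᵥ h := dotProduct_nonneg_of_nonneg (hp t ht) h_nonneg
  have hle (t : ℝ) (ht : 0 ≤ t) : p t ⬝ᵥ h ≤ C * g t := by
    rw [← smul_eq_mul, ← dotProduct_smul]
    refine dotProduct_le_dotProduct_of_nonneg_left (fun x => ?_) (hp t ht)
    by_cases hx : x ∈ A
    · simp [hx, h_zero x hx]
    · simpa [hx, C] using (Finset.single_le_sum (fun y _ => h_nonneg y) (Finset.mem_univ x)).trans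
        (le_add_of_nonneg_left zero_le_one)
  have hderiv (t : ℝ) : HasDerivAt (fun t => p t ⬝ᵥ h) (-g t) t :=
    hA.hasDerivAt_exp_smul_mulVec_apply hB h_zero h_eq t hx₀
  have hC : 0 < C := add_pos_of_pos_of_nonneg one_pos (Finset.sum_nonneg fun x _ => h_nonneg x)
  calc ∫⁻ ω, hittingTime X A ω ∂P
      = ∫⁻ t in Set.Ioi (0 : ℝ), P {ω | ENNReal.ofReal t < hittingTime X A ω} :=
        lintegral_eq_lintegral_meas_ofReal_lt <|
          measurable_hittingTime (fun t => hX.measurableSet_mem t A) hX.rightContinuous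
    _ = ∫⁻ t in Set.Ioi 0, ENNReal.ofReal (g t) := by
        refine setLIntegral_congr_fun measurableSet_Ioi fun t ht => ?_
        lift t to ℝ≥0 using le_of_lt ht
        rw [ENNReal.ofReal_coe_nnreal, ← ofReal_measureReal, hX.measureReal_lt_hittingTime hA]
        rfl
    _ = ENNReal.ofReal (p 0 ⬝ᵥ h) :=
        lintegral_Ioi_of_hasDerivAt_neg (fun t _ => hderiv t) hg <|
          tendsto_zero_of_hasDerivAt_neg_of_le_mul hC (fun t _ => hderiv t) hφ hle
    _ = ENNReal.ofReal (h x₀) := by simp [p, dotProduct, Matrix.one_apply]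

end IsContinuousTimeMarkovChain

section Exponential

@[fun_prop]
lemma measurable_exponentialPDF (r : ℝ) : Measurable (exponentialPDF r) :=
  (measurable_exponentialPDFReal r).ennreal_ofReal

lemma lintegral_expMeasure (r : ℝ) {f : ℝ → ℝ≥0∞} (hf : Measurable f) :
    ∫⁻ x, f x ∂expMeasure r = ∫⁻ x, exponentialPDF r x * f x :=
  lintegral_withDensity_eq_lintegral_mul _ (measurable_exponentialPDF r) hf

lemma nullSingletonClass_expMeasure (r : ℝ) : NullSingletonClass (expMeasure r) where
  measure_singleton x := withDensity_absolutelyContinuous _ _ (measure_singleton x)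

lemma ae_nonneg_expMeasure (r : ℝ) : ∀ᵐ x ∂expMeasure r, 0 ≤ x := by
  have h : expMeasure r (Set.Iio 0) = 0 :=
    (withDensity_apply _ measurableSet_Iio).trans (lintegral_exponentialPDF_of_nonpos le_rfl)
  exact (measure_eq_zero_iff_ae_notMem.1 h).mono fun x hx => not_lt.1 hx

lemma expMeasure_restrict_Ici (r : ℝ) {s : ℝ} (hs : 0 ≤ s) :
    (expMeasure r).restrict (Set.Ici s) =
      ENNReal.ofReal (Real.exp (-(r * s))) • (expMeasure r).map (s + ·) := by
  refine Measure.ext_of_lintegral _ fun f hf => ?_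
  rw [← lintegral_indicator measurableSet_Ici,
    lintegral_expMeasure _ (hf.indicator measurableSet_Ici), lintegral_smul_measure,
    lintegral_map hf (by fun_prop), lintegral_expMeasure _ (by fun_prop), smul_eq_mul,
    ← lintegral_const_mul _ (by fun_prop),
    ← lintegral_add_left_eq_self _ s]
  refine lintegral_congr fun x => ?_
  obtain hx | hx := lt_or_ge x 0
  · simp [exponentialPDF_of_neg hx, hx]
  · have hexp : Real.exp (-(r * (s + x))) = Real.exp (-(r * s)) * Real.exp (-(r * x)) := by
      rw [← Real.exp_add]
      ring_nf
    rw [Set.indicator_of_mem (by simpa using hx), exponentialPDF_of_nonneg (by positivity),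
      exponentialPDF_of_nonneg hx, ← mul_assoc, ← ENNReal.ofReal_mul (Real.exp_nonneg _), hexp,
      mul_left_comm]

lemma lintegral_exp_mul_expMeasure {r m : ℝ} (hr : 0 < r) (hm : 0 ≤ m) {f : ℝ → ℝ≥0∞}
    (hf : Measurable f) :
    ∫⁻ s, ENNReal.ofReal (Real.exp (-(m * s))) * f s ∂expMeasure r =
      ENNReal.ofReal (r / (m + r)) * ∫⁻ s, f s ∂expMeasure (m + r) := by
  rw [lintegral_expMeasure _ (by fun_prop), lintegral_expMeasure _ hf,
    ← lintegral_const_mul _ (by fun_prop)]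
  refine lintegral_congr fun s => ?_
  obtain hs | hs := lt_or_ge s 0
  · simp [exponentialPDF_of_neg hs]
  · have hdens : r * Real.exp (-(r * s)) * Real.exp (-(m * s)) =
        r / (m + r) * ((m + r) * Real.exp (-((m + r) * s))) := by
      rw [mul_assoc, ← Real.exp_add]
      field_simp
      ring_nf
    rw [exponentialPDF_of_nonneg hs, exponentialPDF_of_nonneg hs, ← mul_assoc, ← mul_assoc,
      ← ENNReal.ofReal_mul (by positivity), ← ENNReal.ofReal_mul (by positivity), hdens]

lemma lintegral_ofReal_expMeasure {r : ℝ} (hr : 0 < r) :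
    ∫⁻ s, ENNReal.ofReal s ∂expMeasure r = ENNReal.ofReal (1 / r) := by
  have hgamma (x : ℝ) :
      exponentialPDF r x * ENNReal.ofReal x = ENNReal.ofReal (1 / r) * gammaPDF 2 r x := by
    obtain hx | hx := lt_or_ge x 0
    · simp [exponentialPDF_of_neg hx, gammaPDF_of_neg hx]
    · rw [exponentialPDF_of_nonneg hx, gammaPDF_of_nonneg hx,
        ← ENNReal.ofReal_mul (by positivity), ← ENNReal.ofReal_mul (by positivity),
        show (2 : ℝ) - 1 = 1 by norm_num, Real.rpow_one, Real.Gamma_two, Real.rpow_two]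
      congr 1
      field_simp
  simp_rw [lintegral_expMeasure _ ENNReal.measurable_ofReal, hgamma]
  rw [lintegral_const_mul (f := gammaPDF 2 r) _ (measurable_gammaPDFReal 2 r).ennreal_ofReal,
    lintegral_gammaPDF_eq_one two_pos hr, mul_one]

end Exponential

section Product

variable {ι : Type*}

lemma measurableSet_forall_mem_le {α : Type*} [MeasurableSpace α] (J : Finset ι) {f : α → ℝ}
    {g : ι → α → ℝ} (hf : Measurable f) (hg : ∀ j, Measurable (g j)) :
    MeasurableSet {a | ∀ j ∈ J, f a ≤ g j a} := by
  have h : {a | ∀ j ∈ J, f a ≤ g j a} = ⋂ j ∈ J, {a | f a ≤ g j a} := by ext; simp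
  rw [h]
  exact Finset.measurableSet_biInter J fun j _ => measurableSet_le hf (hg j)

lemma update_smul_indicator_erase_add [DecidableEq ι] {J : Finset ι} {i : ι} (hi : i ∈ J) (s : ℝ)
    (x : ι → ℝ) :
    Function.update (s • (J.erase i : Set ι).indicator 1 + x) i s =
      s • (J : Set ι).indicator 1 + Function.update x i 0 := by
  ext j
  obtain rfl | hj := eq_or_ne j i
  · simp [hi]
  · simp [hj, Set.indicator_apply]

@[fun_prop]
lemma measurable_piecewise_zero [DecidableEq ι] (E : Finset ι) :
    Measurable fun x : ι → ℝ => E.piecewise (0 : ι → ℝ) x := by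
  refine measurable_pi_lambda _ fun i => ?_
  by_cases hi : i ∈ E <;> simp only [hi, not_false_eq_true, Finset.piecewise_eq_of_mem,
    Finset.piecewise_eq_of_notMem] <;> fun_prop

lemma piecewise_zero_smul_indicator_add_update [DecidableEq ι] {E J : Finset ι}
    (hEJ : Disjoint E J) (i : ι) (s : ℝ) (x : ι → ℝ) :
    E.piecewise (0 : ι → ℝ) (s • (J : Set ι).indicator 1 + Function.update x i 0) =
      s • (J : Set ι).indicator 1 + (insert i E).piecewise (0 : ι → ℝ) x := by
  ext j
  by_cases hjE : j ∈ E
  · simp [hjE, Finset.disjoint_left.1 hEJ hjE]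
  · obtain rfl | hji := eq_or_ne j i <;> simp [*]

variable [Fintype ι]

lemma lintegral_pi_eq_lintegral_update [DecidableEq ι] {α : ι → Type*}
    [∀ i, MeasurableSpace (α i)] {μ : ∀ i, Measure (α i)} [∀ i, IsProbabilityMeasure (μ i)] (i : ι)
    {f : (∀ i, α i) → ℝ≥0∞} (hf : Measurable f) :
    ∫⁻ x, f x ∂Measure.pi μ = ∫⁻ s, ∫⁻ x, f (Function.update x i s) ∂Measure.pi μ ∂μ i := by
  have hu : Measurable fun p : (∀ i, α i) × α i => f (Function.update p.1 i p.2) :=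
    hf.comp measurable_update'
  rw [← lintegral_lintegral_swap hu.aemeasurable]
  refine lintegral_eq_of_lmarginal_eq {i} hf hu.lintegral_prod_right' ?_
  simp [lmarginal_singleton]

lemma ae_pi_ne {α : Type*} [MeasurableSpace α] [MeasurableEq α] {μ : ι → Measure α}
    [∀ i, IsProbabilityMeasure (μ i)] {i j : ι} [NullSingletonClass (μ j)] (hij : i ≠ j) :
    ∀ᵐ x ∂Measure.pi μ, x i ≠ x j := by
  classical
  have hs : MeasurableSet {x : ι → α | x i = x j} :=
    measurableSet_eq_fun (measurable_pi_apply i) (measurable_pi_apply j)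
  have hnull : ∫⁻ x, {x : ι → α | x i = x j}.indicator 1 x ∂Measure.pi μ = 0 := by
    rw [lintegral_pi_eq_lintegral_update i (measurable_one.indicator hs)]
    refine lintegral_eq_zero_of_ae_eq_zero <| .of_forall fun s => lintegral_eq_zero_of_ae_eq_zero ?_
    filter_upwards [Measure.ae_eval_ne (μ := μ) j s] with x hx
    simpa [hij.symm] using hx.symm
  rw [lintegral_indicator_one hs] at hnull
  exact measure_eq_zero_iff_ae_notMem.1 hnull

lemma lintegral_pi_eq_sum_setLIntegral_min {μ : ι → Measure ℝ} [∀ i, IsProbabilityMeasure (μ i)]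
    [∀ i, NullSingletonClass (μ i)] {J : Finset ι} (hJ : J.Nonempty) {f : (ι → ℝ) → ℝ≥0∞}
    (hf : Measurable f) :
    ∫⁻ x, f x ∂Measure.pi μ = ∑ i ∈ J, ∫⁻ x in {x | ∀ j ∈ J, x i ≤ x j}, f x ∂Measure.pi μ := by
  have hmeas (i : ι) : MeasurableSet {x : ι → ℝ | ∀ j ∈ J, x i ≤ x j} :=
    measurableSet_forall_mem_le J (measurable_pi_apply i) fun j => measurable_pi_apply j
  have hties : ∀ᵐ x ∂Measure.pi μ, ∀ i j, i ≠ j → x i ≠ x j :=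
    ae_all_iff.2 fun i => ae_all_iff.2 fun j => eventually_imp_distrib_left.2 ae_pi_ne
  simp_rw [← lintegral_indicator (hmeas _)]
  rw [← lintegral_finsetSum _ fun i _ => hf.indicator (hmeas i)]
  refine lintegral_congr_ae ?_
  filter_upwards [hties] with x hx
  obtain ⟨i, hi, hmin⟩ := J.exists_min_image x hJ
  have hfirst : ∀ j ∈ J, j ≠ i → x ∉ {x | ∀ l ∈ J, x j ≤ x l} := fun j hj hji hmin' =>
    hx j i hji (le_antisymm (hmin' i hi) (hmin j hj))
  rw [Finset.sum_eq_single_of_mem i hi fun j hj hji => Set.indicator_of_notMem (hfirst j hj hji) f]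
  exact (Set.indicator_of_mem (show x ∈ {x | ∀ l ∈ J, x i ≤ x l} from hmin) f).symm

lemma setLIntegral_pi_min [DecidableEq ι] {μ : ι → Measure ℝ} [∀ i, IsProbabilityMeasure (μ i)]
    (J : Finset ι) (i : ι) {f : (ι → ℝ) → ℝ≥0∞} (hf : Measurable f) :
    ∫⁻ x in {x | ∀ j ∈ J, x i ≤ x j}, f x ∂Measure.pi μ =
      ∫⁻ s, ∫⁻ x in {x | ∀ j ∈ J.erase i, s ≤ x j}, f (Function.update x i s)
        ∂Measure.pi μ ∂μ i := by
  have hmeas : MeasurableSet {x : ι → ℝ | ∀ j ∈ J, x i ≤ x j} :=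
    measurableSet_forall_mem_le J (measurable_pi_apply i) fun j => measurable_pi_apply j
  rw [← lintegral_indicator hmeas, lintegral_pi_eq_lintegral_update i (hf.indicator hmeas)]
  refine lintegral_congr fun s => ?_
  rw [← lintegral_indicator
    (measurableSet_forall_mem_le _ measurable_const fun j => measurable_pi_apply j)]
  refine lintegral_congr fun x => ?_
  have hiff : (∀ j ∈ J, s ≤ Function.update x i s j) ↔ ∀ j ∈ J.erase i, s ≤ x j := by
    simp only [Finset.mem_erase, Function.update_apply]
    grind
  simp [Set.indicator_apply, hiff]

/-- The joint law of independent exponential times `x i` of rates `r i`. -/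
abbrev piExpMeasure (r : ι → ℝ) : Measure (ι → ℝ) := Measure.pi fun i => expMeasure (r i)

lemma piExpMeasure_restrict (r : ι → ℝ) (hr : ∀ i, 0 < r i) (K : Finset ι) {s : ℝ} (hs : 0 ≤ s) :
    (piExpMeasure r).restrict {x | ∀ j ∈ K, s ≤ x j} =
      ENNReal.ofReal (Real.exp (-((∑ j ∈ K, r j) * s))) •
        (piExpMeasure r).map (s • (K : Set ι).indicator 1 + ·) := by
  classical
  have (i : ι) : IsProbabilityMeasure (expMeasure (r i)) := isProbabilityMeasure_expMeasure (hr i)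
  have hbox : {x : ι → ℝ | ∀ j ∈ K, s ≤ x j} =
      Set.univ.pi fun j => if j ∈ K then Set.Ici s else Set.univ := by
    ext x
    exact (forall_congr' fun j => by by_cases hj : j ∈ K <;> simp [hj]).trans
      Set.mem_univ_pi.symm
  have hmarginal (j : ι) : (expMeasure (r j)).restrict (if j ∈ K then Set.Ici s else Set.univ) =
      (if j ∈ K then ENNReal.ofReal (Real.exp (-(r j * s))) else 1) •
        (expMeasure (r j)).map ((s • (K : Set ι).indicator 1) j + ·) := by
    by_cases hj : j ∈ K
    · simp [hj, expMeasure_restrict_Ici _ hs]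
    · simp [hj]
  have hprod : ∏ j, (if j ∈ K then ENNReal.ofReal (Real.exp (-(r j * s))) else 1) =
      ENNReal.ofReal (Real.exp (-((∑ j ∈ K, r j) * s))) := by
    rw [Finset.prod_ite_mem, Finset.univ_inter, ← ENNReal.ofReal_prod_of_nonneg
      fun _ _ => Real.exp_nonneg _, ← Real.exp_sum, Finset.sum_neg_distrib, Finset.sum_mul]
  have (j : ι) : IsProbabilityMeasure
      ((expMeasure (r j)).map ((s • (K : Set ι).indicator 1) j + ·)) :=
    Measure.isProbabilityMeasure_map (by fun_prop)
  have hmap : (piExpMeasure r).map (s • (K : Set ι).indicator 1 + ·) =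
      Measure.pi fun j => (expMeasure (r j)).map ((s • (K : Set ι).indicator 1) j + ·) :=
    Measure.pi_map_pi fun j => (measurable_const_add _).aemeasurable
  rw [hbox, Measure.restrict_pi_pi, hmap]
  refine Measure.pi_eq fun B _ => ?_
  simp_rw [hmarginal, Measure.smul_apply, smul_eq_mul, Measure.pi_pi, Finset.prod_mul_distrib,
    hprod]

/-- On the right, the clock `i` is the first in `J` to ring, at time `s`, and `x` lists the times
which the clocks still have to run after that. -/
theorem lintegral_piExpMeasure_race [DecidableEq ι] {r : ι → ℝ} (hr : ∀ i, 0 < r i) {J : Finset ι}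
    (hJ : J.Nonempty) {f : (ι → ℝ) → ℝ≥0∞} (hf : Measurable f) :
    ∫⁻ x, f x ∂piExpMeasure r = ∑ i ∈ J, ENNReal.ofReal (r i / ∑ j ∈ J, r j) *
      ∫⁻ s, ∫⁻ x, f (s • (J : Set ι).indicator 1 + Function.update x i 0)
        ∂piExpMeasure r ∂expMeasure (∑ j ∈ J, r j) := by
  have (i : ι) : IsProbabilityMeasure (expMeasure (r i)) := isProbabilityMeasure_expMeasure (hr i)
  have (i : ι) : NullSingletonClass (expMeasure (r i)) := nullSingletonClass_expMeasure (r i)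
  rw [lintegral_pi_eq_sum_setLIntegral_min hJ hf]
  refine Finset.sum_congr rfl fun i hi => ?_
  have hm : 0 ≤ ∑ j ∈ J.erase i, r j := Finset.sum_nonneg fun j _ => (hr j).le
  have hg : Measurable fun s : ℝ => ∫⁻ x,
      f (s • (J : Set ι).indicator 1 + Function.update x i 0) ∂piExpMeasure r :=
    Measurable.lintegral_prod_right' (f := fun p : ℝ × (ι → ℝ) =>
      f (p.1 • (J : Set ι).indicator 1 + Function.update p.2 i 0)) (by fun_prop)
  rw [setLIntegral_pi_min J i hf, ← Finset.sum_erase_add J r hi,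
    ← lintegral_exp_mul_expMeasure (hr i) hm hg]
  refine lintegral_congr_ae ?_
  filter_upwards [ae_nonneg_expMeasure (r i)] with s hs
  rw [piExpMeasure_restrict r hr _ hs, lintegral_smul_measure,
    lintegral_map (by fun_prop) (measurable_const_add _), smul_eq_mul]
  simp_rw [update_smul_indicator_erase_add hi]

lemma ae_nonneg_piExpMeasure {r : ι → ℝ} (hr : ∀ i, 0 < r i) : ∀ᵐ x ∂piExpMeasure r, 0 ≤ x := by
  have (i : ι) : IsProbabilityMeasure (expMeasure (r i)) := isProbabilityMeasure_expMeasure (hr i)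
  exact ae_all_iff.2 fun i =>
    (Measure.quasiMeasurePreserving_eval (fun i => expMeasure (r i)) i).ae
      (ae_nonneg_expMeasure (r i))

/-- First-step analysis: the clocks in `E` have rung, those in `J` are running, and `F` is a
function of the residual times of all clocks. -/
theorem lintegral_piExpMeasure_piecewise [DecidableEq ι] {r : ι → ℝ} (hr : ∀ i, 0 < r i)
    {E J : Finset ι} (hEJ : Disjoint E J) (hJ : J.Nonempty) {F : (ι → ℝ) → ℝ≥0∞}
    (hF : Measurable F) (hdelay : ∀ s, 0 ≤ s → ∀ x, 0 ≤ x → (∀ i ∈ E, x i = 0) →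
      F (s • (J : Set ι).indicator 1 + x) = ENNReal.ofReal s + F x) :
    ∫⁻ x, F (E.piecewise 0 x) ∂piExpMeasure r =
      ENNReal.ofReal (1 / ∑ j ∈ J, r j) + ∑ i ∈ J, ENNReal.ofReal (r i / ∑ j ∈ J, r j) *
        ∫⁻ x, F ((insert i E).piecewise 0 x) ∂piExpMeasure r := by
  have (i : ι) : IsProbabilityMeasure (expMeasure (r i)) := isProbabilityMeasure_expMeasure (hr i)
  have hrace := lintegral_piExpMeasure_race hr hJ (f := fun x => F (E.piecewise 0 x))
    (hF.comp (measurable_piecewise_zero E))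
  set Λ : ℝ := ∑ j ∈ J, r j
  have hΛ : 0 < Λ := Finset.sum_pos (fun j _ => hr j) hJ
  have : IsProbabilityMeasure (expMeasure Λ) := isProbabilityMeasure_expMeasure hΛ
  have hwait (i : ι) (s : ℝ) (hs : 0 ≤ s) : ∫⁻ x,
      F (E.piecewise 0 (s • (J : Set ι).indicator 1 + Function.update x i 0)) ∂piExpMeasure r =
      ENNReal.ofReal s + ∫⁻ x, F ((insert i E).piecewise 0 x) ∂piExpMeasure r := by
    have hF' : ∀ᵐ x ∂piExpMeasure r,
        F (E.piecewise 0 (s • (J : Set ι).indicator 1 + Function.update x i 0)) =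
          ENNReal.ofReal s + F ((insert i E).piecewise 0 x) := by
      filter_upwards [ae_nonneg_piExpMeasure hr] with x hx
      rw [piecewise_zero_smul_indicator_add_update hEJ, hdelay s hs _
        (Finset.le_piecewise_of_le_of_le _ le_rfl hx) fun j hj => by simp [hj]]
    rw [lintegral_congr_ae hF', lintegral_add_left measurable_const, lintegral_const,
      measure_univ, mul_one]
  have hstep (i : ι) : ∫⁻ s, ∫⁻ x,
      F (E.piecewise 0 (s • (J : Set ι).indicator 1 + Function.update x i 0))
        ∂piExpMeasure r ∂expMeasure Λ =
      ENNReal.ofReal (1 / Λ) + ∫⁻ x, F ((insert i E).piecewise 0 x) ∂piExpMeasure r := by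
    rw [lintegral_congr_ae ((ae_nonneg_expMeasure Λ).mono (hwait i)),
      lintegral_add_left ENNReal.measurable_ofReal, lintegral_ofReal_expMeasure hΛ,
      lintegral_const, measure_univ, mul_one]
  have hprob : ∑ i ∈ J, ENNReal.ofReal (r i / Λ) = 1 := by
    rw [← ENNReal.ofReal_sum_of_nonneg fun i _ => (div_pos (hr i) hΛ).le, ← Finset.sum_div,
      div_self hΛ.ne', ENNReal.ofReal_one]
  rw [hrace]
  simp_rw [hstep, mul_add, Finset.sum_add_distrib, ← Finset.sum_mul]
  rw [hprob, one_mul]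

end Product

section KthMin

variable {ι : Type*} [Fintype ι] {k : ℕ} {f g : ι → ℝ}

lemma le_card_filter_le_iff {t : ℝ} : k ≤ (Finset.univ.filter fun i => f i ≤ t).card ↔
    ∃ B ∈ Finset.univ.powersetCard k, ∀ i ∈ B, f i ≤ t := by
  simp [Finset.le_card_iff_exists_subset_card, Finset.subset_iff, and_comm]

lemma kthMin_zero : kthMin 0 f = 0 := by simp [kthMin]

lemma kthMin_of_card_lt (hk : Fintype.card ι < k) : kthMin k f = 0 := by
  have h (t : ℝ) : (Finset.univ.filter fun i => f i ≤ t).card < k :=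
    (Finset.card_le_univ _).trans_lt hk
  simp [kthMin, fun t => not_le.2 (h t)]

lemma kthMin_le_iff (hk : 1 ≤ k) (hkι : k ≤ Fintype.card ι) {t : ℝ} :
    kthMin k f ≤ t ↔ k ≤ (Finset.univ.filter fun i => f i ≤ t).card := by
  set U : Set ℝ := {t : ℝ | k ≤ (Finset.univ.filter fun i => f i ≤ t).card} with hU
  have hupper : IsUpperSet U := fun a b hab ha =>
    ha.trans (Finset.card_le_card (Finset.monotone_filter_right _ fun i _ hi => hi.trans hab))
  have hne : U.Nonempty := by
    obtain ⟨M, hM⟩ := (Set.finite_range f).bddAbove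
    exact ⟨M, by simpa [hU, Finset.filter_true_of_mem fun i _ => hM ⟨i, rfl⟩]⟩
  have hbdd : BddBelow U := by
    obtain ⟨m, hm⟩ := (Set.finite_range f).bddBelow
    refine ⟨m, fun t ht => ?_⟩
    obtain ⟨i, hi⟩ := Finset.card_pos.1 (hk.trans ht)
    exact (hm ⟨i, rfl⟩).trans (Finset.mem_filter.1 hi).2
  have hclosed : IsClosed U := by
    have hUnion : U = ⋃ B ∈ Finset.univ.powersetCard k, ⋂ i ∈ B, Set.Ici (f i) := by
      ext t
      simp only [hU, le_card_filter_le_iff, Set.mem_ofPred_eq, Set.mem_iUnion, Set.mem_iInter,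
        Set.mem_Ici, exists_prop]
    rw [hUnion]
    exact (Finset.finite_toSet _).isClosed_biUnion fun B _ =>
      isClosed_biInter fun i _ => isClosed_Ici
  exact ⟨fun h => hupper h (hclosed.csInf_mem hne hbdd), fun h => csInf_le hbdd h⟩

lemma kthMin_nonneg (hf : ∀ i, 0 ≤ f i) : 0 ≤ kthMin k f := by
  obtain rfl | hk := k.eq_zero_or_pos
  · exact kthMin_zero.ge
  · refine Real.sInf_nonneg fun t ht => ?_
    obtain ⟨i, hi⟩ := Finset.card_pos.1 (hk.trans_le ht)
    exact (hf i).trans (Finset.mem_filter.1 hi).2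

lemma kthMin_eq_zero {A : Finset ι} (hkA : k ≤ A.card) (hf : ∀ i, 0 ≤ f i)
    (hA : ∀ i ∈ A, f i = 0) : kthMin k f = 0 := by
  obtain rfl | hk := k.eq_zero_or_pos
  · exact kthMin_zero
  · refine le_antisymm ((kthMin_le_iff hk (hkA.trans A.card_le_univ)).2 ?_) (kthMin_nonneg hf)
    exact hkA.trans (Finset.card_le_card fun i hi => by simp [hA i hi])

/-- Fewer than `k` of the values of `g` are exempt from the delay, and these are minimal. -/
lemma kthMin_smul_indicator_compl_add (hkι : k ≤ Fintype.card ι) {A : Finset ι} (hkA : A.card < k)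
    {s : ℝ} (hs : 0 ≤ s) (hg : ∀ i, 0 ≤ g i) (hgA : ∀ i ∈ A, g i = 0) :
    kthMin k (s • (A : Set ι)ᶜ.indicator 1 + g) = s + kthMin k g := by
  have hk : 1 ≤ k := by lia
  set f : ι → ℝ := s • (A : Set ι)ᶜ.indicator 1 + g with hf
  have hfA {i : ι} (hi : i ∈ A) : f i = 0 := by simp [hf, hi, hgA]
  have hfAc {i : ι} (hi : i ∉ A) : f i = s + g i := by simp [hf, hi]
  refine eq_of_forall_ge_iff fun t => ?_
  rw [kthMin_le_iff hk hkι, ← le_sub_iff_add_le', kthMin_le_iff hk hkι]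
  obtain ht | ht := lt_or_ge t s
  · have hsubset : (Finset.univ.filter fun i => f i ≤ t) ⊆ A := fun i hi => by
      by_contra hiA
      linarith [hg i, hfAc hiA, (Finset.mem_filter.1 hi).2]
    have hempty : (Finset.univ.filter fun i => g i ≤ t - s) = ∅ :=
      Finset.filter_false_of_mem fun i _ => by linarith [hg i]
    rw [hempty, Finset.card_empty]
    exact iff_of_false (((Finset.card_le_card hsubset).trans_lt hkA).not_ge) (by lia)
  · suffices ∀ i, f i ≤ t ↔ g i ≤ t - s by simp_rw [this]
    intro i
    by_cases hi : i ∈ A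
    · rw [hfA hi, hgA i hi, sub_nonneg]
      exact iff_of_true (hs.trans ht) ht
    · rw [hfAc hi, le_sub_iff_add_le']

lemma measurable_kthMin {α : Type*} [MeasurableSpace α] (k : ℕ) {F : α → ι → ℝ}
    (hF : ∀ i, Measurable fun a => F a i) : Measurable fun a => kthMin k (F a) := by
  obtain rfl | hk := k.eq_zero_or_pos
  · simp only [kthMin_zero, measurable_const]
  obtain hkι | hkι := lt_or_ge (Fintype.card ι) k
  · simp only [kthMin_of_card_lt hkι, measurable_const]
  refine measurable_of_Iic fun t => ?_
  have hUnion : (fun a => kthMin k (F a)) ⁻¹' Set.Iic t =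
      ⋃ B ∈ Finset.univ.powersetCard k, ⋂ i ∈ B, {a | F a i ≤ t} := by
    ext a
    simp only [Set.mem_preimage, Set.mem_Iic, kthMin_le_iff hk hkι, le_card_filter_le_iff,
      Set.mem_ofPred_eq, Set.mem_iUnion, Set.mem_iInter, exists_prop]
  rw [hUnion]
  exact Finset.measurableSet_biUnion _ fun B _ => Finset.measurableSet_biInter _ fun i _ =>
    measurableSet_le (hF i) measurable_const

end KthMin

section Latency

variable {n₁ n₂ k₁ k₂ : ℕ}

/-- The clocks: `Sum.inl (i, j)` stands for `T i j` and `Sum.inr i` for `Tc i`. -/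
abbrev Clock (n₁ n₂ : ℕ) : Type := (Fin n₂ × Fin n₁) ⊕ Fin n₂

/-- `lowerBoundTime` as a function of the times `x` shown by all clocks. -/
def latency (k₁ k₂ : ℕ) (x : Clock n₁ n₂ → ℝ) : ℝ :=
  kthMin k₂ fun i : Fin n₂ => x (Sum.inr i) +
    kthMin (((i : ℕ) + 1) * k₁) fun p : Fin n₂ × Fin n₁ => x (Sum.inl p)

lemma measurable_latency : Measurable (latency k₁ k₂ : (Clock n₁ n₂ → ℝ) → ℝ) :=
  measurable_kthMin _ fun _ => (measurable_pi_apply _).add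
    (measurable_kthMin _ fun _ => measurable_pi_apply _)

lemma latency_nonneg {x : Clock n₁ n₂ → ℝ} (hx : 0 ≤ x) : 0 ≤ latency k₁ k₂ x :=
  kthMin_nonneg fun _ => add_nonneg (hx _) (kthMin_nonneg fun _ => hx _)

/-- The second-stage clocks that have been started once `u` first-stage clocks have rung. -/
def started (n₂ k₁ u : ℕ) : Finset (Fin n₂) := Finset.univ.filter fun i => ((i : ℕ) + 1) * k₁ ≤ u

lemma mem_started {u : ℕ} {i : Fin n₂} : i ∈ started n₂ k₁ u ↔ ((i : ℕ) + 1) * k₁ ≤ u := by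
  simp [started]

lemma started_mono {u v : ℕ} (h : u ≤ v) : started n₂ k₁ u ⊆ started n₂ k₁ v := fun _ hi =>
  mem_started.2 ((mem_started.1 hi).trans h)

lemma card_started (hk₁ : 1 ≤ k₁) {u : ℕ} (hu : u ≤ n₂ * k₁) :
    (started n₂ k₁ u).card = u / k₁ := by
  have hlt : started n₂ k₁ u = Finset.univ.filter fun i : Fin n₂ => (i : ℕ) < u / k₁ :=
    Finset.filter_congr fun i _ => by rw [← Nat.le_div_iff_mul_le hk₁, Nat.succ_le_iff]
  rw [hlt, Fin.card_filter_val_lt, min_eq_right]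
  exact Nat.div_le_of_le_mul (by rwa [mul_comm])

/-- A set `E` of clocks that have rung is admissible if it arises from the chain: a second-stage
clock rings only after it has been started, and the first stage ends after `n₂ * k₁` rings. -/
structure IsAdmissible (k₁ : ℕ) (E : Finset (Clock n₁ n₂)) : Prop where
  card_toLeft_le : E.toLeft.card ≤ n₂ * k₁
  toRight_subset : E.toRight ⊆ started n₂ k₁ E.toLeft.card

/-- The clocks that are running when exactly those in `E` have rung. The first-stage clocks are
switched off after `n₂ * k₁` rings, as the chain ignores them from then on. -/
def running (k₁ : ℕ) (E : Finset (Clock n₁ n₂)) : Finset (Clock n₁ n₂) :=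
  (if E.toLeft.card < n₂ * k₁ then E.toLeftᶜ else ∅).disjSum
    (started n₂ k₁ E.toLeft.card \ E.toRight)

variable {E : Finset (Clock n₁ n₂)}

lemma inl_mem_running {p : Fin n₂ × Fin n₁} :
    Sum.inl p ∈ running k₁ E ↔ E.toLeft.card < n₂ * k₁ ∧ Sum.inl p ∉ E := by
  by_cases h : E.toLeft.card < n₂ * k₁ <;> simp [running, h]

lemma inr_mem_running {i : Fin n₂} :
    Sum.inr i ∈ running k₁ E ↔ i ∈ started n₂ k₁ E.toLeft.card ∧ Sum.inr i ∉ E := by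
  simp [running]

lemma notMem_of_mem_running : ∀ {i : Clock n₁ n₂}, i ∈ running k₁ E → i ∉ E
  | .inl _, hi => (inl_mem_running.1 hi).2
  | .inr _, hi => (inr_mem_running.1 hi).2

lemma IsAdmissible.insert_of_mem_running (hE : IsAdmissible k₁ E) :
    ∀ {i : Clock n₁ n₂}, i ∈ running k₁ E → IsAdmissible k₁ (insert i E)
  | .inl p, hi => by
    obtain ⟨hlt, hp⟩ := inl_mem_running.1 hi
    have hcard : (insert p E.toLeft).card = E.toLeft.card + 1 :=
      Finset.card_insert_of_notMem (by simpa using hp)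
    constructor
    · rw [Finset.toLeft_insert_inl, hcard]
      exact hlt
    · rw [Finset.toLeft_insert_inl, Finset.toRight_insert_inl, hcard]
      exact hE.toRight_subset.trans (started_mono (Nat.le_succ _))
  | .inr i, hi => by
    constructor
    · rw [Finset.toLeft_insert_inr]
      exact hE.card_toLeft_le
    · rw [Finset.toLeft_insert_inr, Finset.toRight_insert_inr]
      exact Finset.insert_subset (inr_mem_running.1 hi).1 hE.toRight_subset

lemma kthMin_inl_eq_zero {i : Fin n₂} (hi : i ∈ started n₂ k₁ E.toLeft.card)
    {x : Clock n₁ n₂ → ℝ} (hx : 0 ≤ x) (hxE : ∀ i ∈ E, x i = 0) :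
    kthMin (((i : ℕ) + 1) * k₁) (fun p : Fin n₂ × Fin n₁ => x (Sum.inl p)) = 0 :=
  kthMin_eq_zero (mem_started.1 hi) (fun _ => hx _) fun _ hp => hxE _ (Finset.mem_toLeft.1 hp)

lemma latency_eq_zero (hE : IsAdmissible k₁ E) (hk₂ : k₂ ≤ E.toRight.card)
    {x : Clock n₁ n₂ → ℝ} (hx : 0 ≤ x) (hxE : ∀ i ∈ E, x i = 0) : latency k₁ k₂ x = 0 := by
  refine kthMin_eq_zero hk₂ (fun i => add_nonneg (hx _) (kthMin_nonneg fun _ => hx _))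
    fun i hi => ?_
  rw [hxE _ (Finset.mem_toRight.1 hi), kthMin_inl_eq_zero (hE.toRight_subset hi) hx hxE, add_zero]

lemma kthMin_inl_smul_indicator_running_add (hkn₁ : k₁ ≤ n₁) {i : Fin n₂}
    (hi : i ∉ started n₂ k₁ E.toLeft.card) {s : ℝ} (hs : 0 ≤ s) {x : Clock n₁ n₂ → ℝ} (hx : 0 ≤ x)
    (hxE : ∀ i ∈ E, x i = 0) :
    kthMin (((i : ℕ) + 1) * k₁) (fun p : Fin n₂ × Fin n₁ =>
        (s • (running k₁ E : Set (Clock n₁ n₂)).indicator 1 + x : Clock n₁ n₂ → ℝ) (Sum.inl p)) =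
      s + kthMin (((i : ℕ) + 1) * k₁) fun p : Fin n₂ × Fin n₁ => x (Sum.inl p) := by
  have hcard : E.toLeft.card < ((i : ℕ) + 1) * k₁ := by simpa [mem_started] using hi
  have hlt : E.toLeft.card < n₂ * k₁ := hcard.trans_le (Nat.mul_le_mul_right _ i.2)
  have hrank : ((i : ℕ) + 1) * k₁ ≤ Fintype.card (Fin n₂ × Fin n₁) := by
    simpa using Nat.mul_le_mul (Nat.succ_le_of_lt i.2) hkn₁
  rw [← kthMin_smul_indicator_compl_add hrank hcard hs (fun _ => hx _) fun p hp =>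
    hxE _ (Finset.mem_toLeft.1 hp)]
  congr 1
  ext p
  simp [Set.indicator_apply, inl_mem_running, hlt]

/-- The groups in `E.toRight` are complete, those in `started` wait for their second-stage clock and
all others for a first-stage clock, so every group that is not complete is delayed by `s`. -/
lemma latency_smul_indicator_running_add (hkn₁ : k₁ ≤ n₁) (hkn₂ : k₂ ≤ n₂)
    (hE : IsAdmissible k₁ E) (hk₂ : E.toRight.card < k₂) {s : ℝ} (hs : 0 ≤ s)
    {x : Clock n₁ n₂ → ℝ} (hx : 0 ≤ x) (hxE : ∀ i ∈ E, x i = 0) :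
    latency k₁ k₂ (s • (running k₁ E : Set (Clock n₁ n₂)).indicator 1 + x) =
      s + latency k₁ k₂ x := by
  set y : Clock n₁ n₂ → ℝ := s • (running k₁ E : Set (Clock n₁ n₂)).indicator 1 + x with hy
  have hy_nonneg : 0 ≤ y :=
    add_nonneg (smul_nonneg hs (Set.indicator_nonneg fun _ _ => zero_le_one)) hx
  have hyE : ∀ i ∈ E, y i = 0 := fun i hi => by
    simp [hy, hxE i hi, mt notMem_of_mem_running (not_not.2 hi)]
  rw [latency, latency, ← kthMin_smul_indicator_compl_add (by simpa using hkn₂) hk₂ hs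
    (fun i => add_nonneg (hx _) (kthMin_nonneg fun _ => hx _)) fun i hi => by
      rw [hxE _ (Finset.mem_toRight.1 hi), kthMin_inl_eq_zero (hE.toRight_subset hi) hx hxE,
        add_zero]]
  congr 1
  ext i
  by_cases hi : i ∈ started n₂ k₁ E.toLeft.card
  · rw [kthMin_inl_eq_zero hi hy_nonneg hyE]
    simp [kthMin_inl_eq_zero hi hx hxE, hy, hi, Set.indicator_apply, inr_mem_running]
  · have hiE : Sum.inr i ∉ E := fun h => hi (hE.toRight_subset (Finset.mem_toRight.2 h))
    rw [kthMin_inl_smul_indicator_running_add hkn₁ hi hs hx hxE]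
    have hyi : y (Sum.inr i) = x (Sum.inr i) := by simp [hy, hi, inr_mem_running]
    rw [hyi, add_left_comm]
    simp [hiE]

end Latency

section MeanTime

variable {n₁ n₂ k₁ k₂ : ℕ} {μ₁ μ₂ : ℝ}

/-- The total rate of the running first-stage clocks when `u` first-stage clocks have rung. -/
def fstRate (n₁ n₂ k₁ : ℕ) (μ₁ : ℝ) (u : ℕ) : ℝ :=
  if u < n₂ * k₁ then ((n₁ * n₂ - u : ℕ) : ℝ) * μ₁ else 0

/-- The total rate of the running second-stage clocks when `u` first-stage and `v` second-stage
clocks have rung; the truncated subtraction makes it `0` for the impossible `v > u / k₁`. -/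
def sndRate (k₁ : ℕ) (μ₂ : ℝ) (u v : ℕ) : ℝ := ((u / k₁ - v : ℕ) : ℝ) * μ₂

lemma fstRate_nonneg (hμ₁ : 0 < μ₁) (u : ℕ) : 0 ≤ fstRate n₁ n₂ k₁ μ₁ u := by
  unfold fstRate
  positivity

lemma sndRate_nonneg (hμ₂ : 0 < μ₂) (u v : ℕ) : 0 ≤ sndRate k₁ μ₂ u v := by
  unfold sndRate
  positivity

lemma fstRate_add_sndRate_pos (hk₁ : 1 ≤ k₁) (hkn₁ : k₁ ≤ n₁) (hkn₂ : k₂ ≤ n₂) (hμ₁ : 0 < μ₁)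
    (hμ₂ : 0 < μ₂) {u v : ℕ} (hu : u ≤ n₂ * k₁) (hv : v < k₂) :
    0 < fstRate n₁ n₂ k₁ μ₁ u + sndRate k₁ μ₂ u v := by
  obtain h | rfl := hu.lt_or_eq
  · have hnu : 0 < n₁ * n₂ - u :=
      Nat.sub_pos_of_lt (h.trans_le (mul_comm n₁ n₂ ▸ Nat.mul_le_mul_left n₂ hkn₁))
    refine add_pos_of_pos_of_nonneg ?_ (sndRate_nonneg hμ₂ u v)
    rw [fstRate, if_pos h]
    positivity
  · have hnv : 0 < n₂ - v := by lia
    refine add_pos_of_nonneg_of_pos (fstRate_nonneg hμ₁ _) ?_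
    rw [sndRate, Nat.mul_div_cancel _ hk₁]
    positivity

/-- The expected remaining time when `u` first-stage and `v` second-stage clocks have rung, as
determined by first-step analysis. -/
def meanTime (n₁ n₂ k₁ k₂ : ℕ) (μ₁ μ₂ : ℝ) (u v : ℕ) : ℝ :=
  if u ≤ n₂ * k₁ ∧ v < k₂ then
    (1 + fstRate n₁ n₂ k₁ μ₁ u * meanTime n₁ n₂ k₁ k₂ μ₁ μ₂ (u + 1) v +
      sndRate k₁ μ₂ u v * meanTime n₁ n₂ k₁ k₂ μ₁ μ₂ u (v + 1)) /
      (fstRate n₁ n₂ k₁ μ₁ u + sndRate k₁ μ₂ u v)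
  else 0
termination_by (n₂ * k₁ + 1 - u) + (k₂ - v)

lemma meanTime_of_le {u v : ℕ} (hv : k₂ ≤ v) : meanTime n₁ n₂ k₁ k₂ μ₁ μ₂ u v = 0 := by
  rw [meanTime, if_neg (by lia)]

lemma meanTime_nonneg (hμ₁ : 0 < μ₁) (hμ₂ : 0 < μ₂) (u v : ℕ) :
    0 ≤ meanTime n₁ n₂ k₁ k₂ μ₁ μ₂ u v := by
  fun_induction meanTime n₁ n₂ k₁ k₂ μ₁ μ₂ u v with
  | case1 u v _ hfst hsnd =>
    have := fstRate_nonneg (n₁ := n₁) (n₂ := n₂) (k₁ := k₁) hμ₁ u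
    have := sndRate_nonneg (k₁ := k₁) hμ₂ u v
    positivity
  | case2 => exact le_rfl

lemma mul_meanTime (hk₁ : 1 ≤ k₁) (hkn₁ : k₁ ≤ n₁) (hkn₂ : k₂ ≤ n₂) (hμ₁ : 0 < μ₁)
    (hμ₂ : 0 < μ₂) {u v : ℕ} (hu : u ≤ n₂ * k₁) (hv : v < k₂) :
    (fstRate n₁ n₂ k₁ μ₁ u + sndRate k₁ μ₂ u v) * meanTime n₁ n₂ k₁ k₂ μ₁ μ₂ u v =
      1 + (fstRate n₁ n₂ k₁ μ₁ u * meanTime n₁ n₂ k₁ k₂ μ₁ μ₂ (u + 1) v +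
        sndRate k₁ μ₂ u v * meanTime n₁ n₂ k₁ k₂ μ₁ μ₂ u (v + 1)) := by
  rw [meanTime, if_pos ⟨hu, hv⟩, add_assoc]
  exact mul_div_cancel₀ _ (fstRate_add_sndRate_pos hk₁ hkn₁ hkn₂ hμ₁ hμ₂ hu hv).ne'

end MeanTime

section ExpectedLatency

variable {n₁ n₂ k₁ k₂ : ℕ} {μ₁ μ₂ : ℝ}

/-- The rates of the clocks: `μ₁` in the first and `μ₂` in the second stage. -/
def clockRate (μ₁ μ₂ : ℝ) : Clock n₁ n₂ → ℝ := Sum.elim (fun _ => μ₁) fun _ => μ₂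

lemma clockRate_pos (hμ₁ : 0 < μ₁) (hμ₂ : 0 < μ₂) : ∀ i : Clock n₁ n₂, 0 < clockRate μ₁ μ₂ i
  | .inl _ => hμ₁
  | .inr _ => hμ₂

variable {E : Finset (Clock n₁ n₂)}

lemma sum_running_clockRate_mul (hk₁ : 1 ≤ k₁) (hE : IsAdmissible k₁ E) (f : ℕ → ℕ → ℝ) :
    ∑ i ∈ running k₁ E, clockRate μ₁ μ₂ i *
        f (insert i E).toLeft.card (insert i E).toRight.card =
      fstRate n₁ n₂ k₁ μ₁ E.toLeft.card * f (E.toLeft.card + 1) E.toRight.card +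
        sndRate k₁ μ₂ E.toLeft.card E.toRight.card * f E.toLeft.card (E.toRight.card + 1) := by
  have hfst : ∀ p ∈ (if E.toLeft.card < n₂ * k₁ then E.toLeftᶜ else ∅),
      clockRate μ₁ μ₂ (Sum.inl p : Clock n₁ n₂) *
        f (insert (Sum.inl p) E).toLeft.card (insert (Sum.inl p) E).toRight.card =
      μ₁ * f (E.toLeft.card + 1) E.toRight.card := fun p hp => by
    have hpE : p ∉ E.toLeft := by split_ifs at hp <;> simp_all
    rw [Finset.toLeft_insert_inl, Finset.toRight_insert_inl, Finset.card_insert_of_notMem hpE]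
    rfl
  have hsnd : ∀ i ∈ started n₂ k₁ E.toLeft.card \ E.toRight,
      clockRate μ₁ μ₂ (Sum.inr i : Clock n₁ n₂) *
        f (insert (Sum.inr i) E).toLeft.card (insert (Sum.inr i) E).toRight.card =
      μ₂ * f E.toLeft.card (E.toRight.card + 1) := fun i hi => by
    rw [Finset.toLeft_insert_inr, Finset.toRight_insert_inr,
      Finset.card_insert_of_notMem (Finset.mem_sdiff.1 hi).2]
    rfl
  rw [running, Finset.sum_disjSum, Finset.sum_congr rfl hfst, Finset.sum_congr rfl hsnd,
    Finset.sum_const, Finset.sum_const, Finset.card_sdiff_of_subset hE.toRight_subset,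
    card_started hk₁ hE.card_toLeft_le, fstRate, sndRate]
  split_ifs
  · simp [Finset.card_compl, mul_comm n₁, mul_assoc]
  · simp [mul_assoc]

lemma sum_running_clockRate (hk₁ : 1 ≤ k₁) (hE : IsAdmissible k₁ E) :
    ∑ i ∈ running k₁ E, clockRate μ₁ μ₂ i =
      fstRate n₁ n₂ k₁ μ₁ E.toLeft.card + sndRate k₁ μ₂ E.toLeft.card E.toRight.card := by
  simpa only [mul_one] using sum_running_clockRate_mul hk₁ hE fun _ _ => 1

lemma meanTime_eq_sum_running (hk₁ : 1 ≤ k₁) (hkn₁ : k₁ ≤ n₁) (hkn₂ : k₂ ≤ n₂) (hμ₁ : 0 < μ₁)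
    (hμ₂ : 0 < μ₂) (hE : IsAdmissible k₁ E) (hk₂ : E.toRight.card < k₂) :
    meanTime n₁ n₂ k₁ k₂ μ₁ μ₂ E.toLeft.card E.toRight.card =
      1 / (∑ i ∈ running k₁ E, clockRate μ₁ μ₂ i) +
        ∑ i ∈ running k₁ E, clockRate μ₁ μ₂ i / (∑ i ∈ running k₁ E, clockRate μ₁ μ₂ i) *
          meanTime n₁ n₂ k₁ k₂ μ₁ μ₂ (insert i E).toLeft.card (insert i E).toRight.card := by
  have hpos := fstRate_add_sndRate_pos hk₁ hkn₁ hkn₂ hμ₁ hμ₂ hE.card_toLeft_le hk₂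
  simp_rw [div_mul_eq_mul_div]
  rw [← Finset.sum_div, ← add_div, sum_running_clockRate_mul hk₁ hE, sum_running_clockRate hk₁ hE,
    ← mul_meanTime hk₁ hkn₁ hkn₂ hμ₁ hμ₂ hE.card_toLeft_le hk₂]
  exact (mul_div_cancel_left₀ _ hpos.ne').symm

theorem lintegral_latency_piecewise (hk₁ : 1 ≤ k₁) (hkn₁ : k₁ ≤ n₁) (hkn₂ : k₂ ≤ n₂)
    (hμ₁ : 0 < μ₁) (hμ₂ : 0 < μ₂) (hE : IsAdmissible k₁ E) :
    ∫⁻ x, ENNReal.ofReal (latency k₁ k₂ (E.piecewise 0 x)) ∂piExpMeasure (clockRate μ₁ μ₂) =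
      ENNReal.ofReal (meanTime n₁ n₂ k₁ k₂ μ₁ μ₂ E.toLeft.card E.toRight.card) := by
  have hr := clockRate_pos (n₁ := n₁) (n₂ := n₂) hμ₁ hμ₂
  have hm := meanTime_nonneg (n₁ := n₁) (n₂ := n₂) (k₁ := k₁) (k₂ := k₂) hμ₁ hμ₂
  induction E using WellFoundedGT.induction with | ind E ih =>
  obtain hk₂ | hk₂ := le_or_gt k₂ E.toRight.card
  · rw [meanTime_of_le hk₂, ENNReal.ofReal_zero]
    refine lintegral_eq_zero_of_ae_eq_zero ?_
    filter_upwards [ae_nonneg_piExpMeasure hr] with x hx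
    rw [latency_eq_zero hE hk₂ (Finset.le_piecewise_of_le_of_le _ le_rfl hx)
      fun i hi => by simp [hi], ENNReal.ofReal_zero, Pi.zero_apply]
  have hpos := fstRate_add_sndRate_pos hk₁ hkn₁ hkn₂ hμ₁ hμ₂ hE.card_toLeft_le hk₂
  rw [← sum_running_clockRate hk₁ hE] at hpos
  rw [lintegral_piExpMeasure_piecewise hr
    (Finset.disjoint_right.2 fun _ => notMem_of_mem_running)
    (Finset.nonempty_of_sum_ne_zero hpos.ne') measurable_latency.ennreal_ofReal
    fun s hs x hx hxE => by
      rw [latency_smul_indicator_running_add hkn₁ hkn₂ hE hk₂ hs hx hxE,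
        ENNReal.ofReal_add hs (latency_nonneg hx)],
    meanTime_eq_sum_running hk₁ hkn₁ hkn₂ hμ₁ hμ₂ hE hk₂]
  have hterm (i : Clock n₁ n₂) : 0 ≤
      clockRate μ₁ μ₂ i / (∑ i ∈ running k₁ E, clockRate μ₁ μ₂ i) *
        meanTime n₁ n₂ k₁ k₂ μ₁ μ₂ (insert i E).toLeft.card (insert i E).toRight.card :=
    mul_nonneg (div_pos (hr i) hpos).le (hm _ _)
  rw [ENNReal.ofReal_add (one_div_pos.2 hpos).le (Finset.sum_nonneg fun i _ => hterm i),
    ENNReal.ofReal_sum_of_nonneg fun i _ => hterm i]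
  refine congrArg _ (Finset.sum_congr rfl fun i hi => ?_)
  rw [ih (insert i E) (Finset.ssubset_insert (notMem_of_mem_running hi))
    (hE.insert_of_mem_running hi), ENNReal.ofReal_mul (div_pos (hr i) hpos).le]

end ExpectedLatency

section Generator

variable {S : Type*} [Fintype S] [DecidableEq S]

lemma generator_apply_of_ne (r : S → S → ℝ) {x y : S} (h : x ≠ y) : generator r x y = r x y :=
  if_neg h

lemma generator_apply_self (r : S → S → ℝ) (x : S) :
    generator r x x = -∑ z ∈ Finset.univ.erase x, r x z :=
  if_pos rfl

lemma isClosedClass_generator {r : S → S → ℝ} {B : Set S}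
    (h : ∀ x ∈ B, ∀ y, r x y ≠ 0 → y ∈ B) : IsClosedClass (generator r) B := by
  intro x hx y hy
  rw [generator_apply_of_ne r (ne_of_mem_of_not_mem hx hy)]
  exact not_not.1 (mt (h x hx y) hy)

lemma generator_mulVec (r : S → S → ℝ) (h : S → ℝ) (x : S) :
    (generator r *ᵥ h) x = ∑ y, r x y * (h y - h x) := by
  have hoff : ∑ y ∈ Finset.univ.erase x, generator r x y * h y =
      ∑ y ∈ Finset.univ.erase x, r x y * h y :=
    Finset.sum_congr rfl fun y hy => by
      rw [generator_apply_of_ne r (Finset.ne_of_mem_erase hy).symm]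
  rw [Matrix.mulVec, dotProduct, ← Finset.add_sum_erase _ _ (Finset.mem_univ x),
    ← Finset.add_sum_erase _ (fun y => r x y * (h y - h x)) (Finset.mem_univ x), hoff,
    generator_apply_self]
  simp_rw [mul_sub, Finset.sum_sub_distrib, neg_mul, Finset.sum_mul]
  ring

end Generator

section AuxiliaryChain

variable {n₁ n₂ k₁ k₂ : ℕ} {μ₁ μ₂ : ℝ}

/-- The states `(u, v)` with `v * k₁ ≤ u`, which the chain does not leave. -/
def reachable (n₂ k₁ k₂ : ℕ) : Set (State n₂ k₁ k₂) := {s | (s.2 : ℕ) * k₁ ≤ (s.1 : ℕ)}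

lemma rate_eq (hk₁ : 1 ≤ k₁) (hkn₁ : k₁ ≤ n₁) {x : State n₂ k₁ k₂} (hx : x ∈ reachable n₂ k₁ k₂)
    (y : State n₂ k₁ k₂) :
    rate n₁ n₂ k₁ k₂ μ₁ μ₂ x y =
      (if (y.1 : ℕ) = x.1 + 1 ∧ (y.2 : ℕ) = x.2 then fstRate n₁ n₂ k₁ μ₁ x.1 else 0) +
      (if (y.1 : ℕ) = x.1 ∧ (y.2 : ℕ) = x.2 + 1 then sndRate k₁ μ₂ x.1 x.2 else 0) := by
  have hv : (x.2 : ℕ) ≤ x.1 / k₁ := (Nat.le_div_iff_mul_le hk₁).2 hx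
  have hnk : n₂ * k₁ ≤ n₁ * n₂ := mul_comm n₁ n₂ ▸ Nat.mul_le_mul_left n₂ hkn₁
  by_cases hfst : (y.1 : ℕ) = x.1 + 1 ∧ (y.2 : ℕ) = x.2
  · have hlt : (x.1 : ℕ) < n₂ * k₁ := by lia
    rw [rate, if_pos ⟨hfst.1, hfst.2, hx, hlt⟩, if_pos hfst, if_neg (by lia), add_zero, fstRate,
      if_pos hlt, Nat.cast_sub (by lia), Nat.cast_mul]
  rw [rate, if_neg fun h => hfst ⟨h.1, h.2.1⟩, if_neg hfst, zero_add]
  by_cases hsnd : (y.1 : ℕ) = x.1 ∧ (y.2 : ℕ) = x.2 + 1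
  · rw [if_pos hsnd, sndRate, Nat.cast_sub hv]
    obtain hlt | heq := hv.lt_or_eq
    · rw [if_pos ⟨hsnd.1, hsnd.2, lt_min hlt (by lia)⟩]
    · rw [if_neg fun h => (lt_min_iff.1 h.2.2).1.ne heq, heq, sub_self, zero_mul]
  · rw [if_neg fun h => hsnd ⟨h.1, h.2.1⟩, if_neg hsnd]

lemma isClosedClass_reachable (hk₁ : 1 ≤ k₁) :
    IsClosedClass (generator (rate n₁ n₂ k₁ k₂ μ₁ μ₂)) (reachable n₂ k₁ k₂) := by
  refine isClosedClass_generator fun x hx y hxy => ?_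
  simp only [rate] at hxy
  simp only [reachable, Set.mem_ofPred_eq] at hx ⊢
  split_ifs at hxy with hfst hsnd
  · rw [hfst.1, hfst.2.1]
    exact Nat.le_succ_of_le hx
  · rw [hsnd.1, hsnd.2.1]
    exact (Nat.le_div_iff_mul_le hk₁).1 (hsnd.2.2.trans_le (min_le_left _ _))
  · exact absurd rfl hxy

lemma isClosedClass_target :
    IsClosedClass (generator (rate n₁ n₂ k₁ k₂ μ₁ μ₂)) (target n₂ k₁ k₂) := by
  refine isClosedClass_generator fun x hx y hxy => ?_
  simp only [rate] at hxy
  simp only [target, Set.mem_ofPred_eq] at hx ⊢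
  split_ifs at hxy with hfst hsnd
  · lia
  · exact absurd hx.1 (lt_min_iff.1 hsnd.2.2).2.ne
  · exact absurd rfl hxy

lemma sum_state_ite_mul {c : ℝ} {f : ℕ → ℕ → ℝ} {a b : ℕ} (ha : c ≠ 0 → a ≤ n₂ * k₁)
    (hb : b ≤ k₂) :
    ∑ y : State n₂ k₁ k₂, (if (y.1 : ℕ) = a ∧ (y.2 : ℕ) = b then c else 0) * f y.1 y.2 =
      c * f a b := by
  obtain rfl | hc := eq_or_ne c 0
  · simp
  let s : State n₂ k₁ k₂ := (⟨a, Nat.lt_succ_of_le (ha hc)⟩, ⟨b, Nat.lt_succ_of_le hb⟩)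
  rw [Finset.sum_eq_single_of_mem s (Finset.mem_univ s), if_pos ⟨rfl, rfl⟩]
  intro y _ hy
  rw [if_neg fun h => hy (Prod.ext (Fin.ext h.1) (Fin.ext h.2)), zero_mul]

lemma generator_mulVec_meanTime (hk₁ : 1 ≤ k₁) (hkn₁ : k₁ ≤ n₁) (hkn₂ : k₂ ≤ n₂) (hμ₁ : 0 < μ₁)
    (hμ₂ : 0 < μ₂) {x : State n₂ k₁ k₂} (hx : x ∈ reachable n₂ k₁ k₂) (hxt : x ∉ target n₂ k₁ k₂) :
    (generator (rate n₁ n₂ k₁ k₂ μ₁ μ₂) *ᵥ fun y => meanTime n₁ n₂ k₁ k₂ μ₁ μ₂ y.1 y.2) x = -1 := by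
  have hu : (x.1 : ℕ) ≤ n₂ * k₁ := Nat.le_of_lt_succ x.1.2
  have hv : (x.2 : ℕ) < k₂ :=
    (Nat.le_of_lt_succ x.2.2).lt_of_ne fun h => hxt ⟨h, (Nat.mul_le_mul_right k₁ h.ge).trans hx⟩
  have hfst : fstRate n₁ n₂ k₁ μ₁ x.1 ≠ 0 → (x.1 : ℕ) + 1 ≤ n₂ * k₁ := fun h => by
    by_contra hlt
    exact h (if_neg hlt)
  let f : ℕ → ℕ → ℝ := fun u v =>
    meanTime n₁ n₂ k₁ k₂ μ₁ μ₂ u v - meanTime n₁ n₂ k₁ k₂ μ₁ μ₂ x.1 x.2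
  rw [generator_mulVec]
  simp_rw [rate_eq hk₁ hkn₁ hx, add_mul]
  rw [Finset.sum_add_distrib, sum_state_ite_mul (f := f) hfst hv.le,
    sum_state_ite_mul (f := f) (fun _ => hu) hv]
  linarith [mul_meanTime hk₁ hkn₁ hkn₂ hμ₁ hμ₂ hu hv]

theorem lintegral_hittingTime_target (hk₁ : 1 ≤ k₁) (hkn₁ : k₁ ≤ n₁) (hkn₂ : k₂ ≤ n₂)
    (hμ₁ : 0 < μ₁) (hμ₂ : 0 < μ₂) {Ω : Type*} [MeasurableSpace Ω] {P : Measure Ω}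
    [IsProbabilityMeasure P] {X : ℝ≥0 → Ω → State n₂ k₁ k₂}
    (hX : IsContinuousTimeMarkovChain (generator (rate n₁ n₂ k₁ k₂ μ₁ μ₂)) (0, 0) X P) :
    ∫⁻ ω, hittingTime X (target n₂ k₁ k₂) ω ∂P =
      ENNReal.ofReal (meanTime n₁ n₂ k₁ k₂ μ₁ μ₂ 0 0) :=
  hX.lintegral_hittingTime (h := fun x => meanTime n₁ n₂ k₁ k₂ μ₁ μ₂ x.1 x.2)
    isClosedClass_target (isClosedClass_reachable hk₁) (by simp [reachable])
    (fun _ => meanTime_nonneg hμ₁ hμ₂ _ _) (fun _ hx => meanTime_of_le hx.1.ge)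
    fun _ hx hxt => generator_mulVec_meanTime hk₁ hkn₁ hkn₂ hμ₁ hμ₂ hx hxt

end AuxiliaryChain

section Law

variable {n₁ n₂ k₁ k₂ : ℕ} {μ₁ μ₂ : ℝ}

lemma lintegral_latency (hk₁ : 1 ≤ k₁) (hkn₁ : k₁ ≤ n₁) (hkn₂ : k₂ ≤ n₂) (hμ₁ : 0 < μ₁)
    (hμ₂ : 0 < μ₂) :
    ∫⁻ x : Clock n₁ n₂ → ℝ, ENNReal.ofReal (latency k₁ k₂ x) ∂piExpMeasure (clockRate μ₁ μ₂) =
      ENNReal.ofReal (meanTime n₁ n₂ k₁ k₂ μ₁ μ₂ 0 0) := by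
  have hE : IsAdmissible k₁ (∅ : Finset (Clock n₁ n₂)) :=
    ⟨Nat.zero_le _, Finset.empty_subset _⟩
  have h := lintegral_latency_piecewise hk₁ hkn₁ hkn₂ hμ₁ hμ₂ hE
  simp_rw [Finset.piecewise_empty] at h
  exact h

lemma lowerBoundTime_eq_latency {Ω : Type*} (T : Fin n₂ → Fin n₁ → Ω → ℝ) (Tc : Fin n₂ → Ω → ℝ) :
    lowerBoundTime k₁ k₂ T Tc = fun ω => latency k₁ k₂ fun i : Clock n₁ n₂ =>
      (Sum.elim (fun p => T p.1 p.2) Tc : Clock n₁ n₂ → Ω → ℝ) i ω :=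
  rfl

lemma hasLaw_clocks {Ω : Type*} [MeasurableSpace Ω] {ν : Measure Ω}
    {T : Fin n₂ → Fin n₁ → Ω → ℝ} {Tc : Fin n₂ → Ω → ℝ}
    (hT : ∀ i j, HasLaw (T i j) (expMeasure μ₁) ν) (hTc : ∀ i, HasLaw (Tc i) (expMeasure μ₂) ν)
    (hindep : iIndepFun (Sum.elim (fun p => T p.1 p.2) Tc : Clock n₁ n₂ → Ω → ℝ) ν) :
    HasLaw (fun ω i => (Sum.elim (fun p => T p.1 p.2) Tc : Clock n₁ n₂ → Ω → ℝ) i ω)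
      (piExpMeasure (clockRate μ₁ μ₂)) ν :=
  hindep.hasLaw_pi fun
    | .inl p => hT p.1 p.2
    | .inr i => hTc i

end Law

end HierCoding

end

open HierCoding in
theorem lemma1 (n₁ n₂ k₁ k₂ : ℕ) (hk₁ : 1 ≤ k₁) (hkn₁ : k₁ ≤ n₁) (hk₂ : 1 ≤ k₂) (hkn₂ : k₂ ≤ n₂)
    (μ₁ μ₂ : ℝ) (hμ₁ : 0 < μ₁) (hμ₂ : 0 < μ₂)
    -- the latencies: mutually independent, exponential with rates `μ₁` and `μ₂`
    {Ω : Type*} [MeasurableSpace Ω] (ν : Measure Ω) [IsProbabilityMeasure ν]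
    (T : Fin n₂ → Fin n₁ → Ω → ℝ) (Tc : Fin n₂ → Ω → ℝ)
    (hT : ∀ i j, HasLaw (T i j) (expMeasure μ₁) ν)
    (hTc : ∀ i, HasLaw (Tc i) (expMeasure μ₂) ν)
    (hindep : iIndepFun
      (Sum.elim (fun p : Fin n₂ × Fin n₁ => T p.1 p.2) Tc : (Fin n₂ × Fin n₁) ⊕ Fin n₂ → Ω → ℝ) ν)
    -- the auxiliary chain, started at `(0, 0)`
    {Ω' : Type*} [MeasurableSpace Ω'] (P : Measure Ω') [IsProbabilityMeasure P]
    (X : ℝ≥0 → Ω' → HierCoding.State n₂ k₁ k₂)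
    (hX : HierCoding.IsContinuousTimeMarkovChain
      (HierCoding.generator (HierCoding.rate n₁ n₂ k₁ k₂ μ₁ μ₂)) (0, 0) X P) :
    Integrable (HierCoding.lowerBoundTime k₁ k₂ T Tc) ν ∧
    AEMeasurable (HierCoding.hittingTime X (HierCoding.target n₂ k₁ k₂)) P ∧
    ∫⁻ ω, HierCoding.hittingTime X (HierCoding.target n₂ k₁ k₂) ω ∂P =
      ENNReal.ofReal (∫ ω, HierCoding.lowerBoundTime k₁ k₂ T Tc ω ∂ν) := by
  have hlaw := hasLaw_clocks hT hTc hindep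
  rw [lowerBoundTime_eq_latency]
  set L : Ω → ℝ := fun ω => latency k₁ k₂ _
  have hmeas : AEMeasurable L ν := measurable_latency.comp_aemeasurable hlaw.aemeasurable
  have hnonneg : 0 ≤ᵐ[ν] L :=
    (ae_of_ae_map hlaw.aemeasurable
      (hlaw.map_eq ▸ ae_nonneg_piExpMeasure (clockRate_pos hμ₁ hμ₂))).mono
      fun _ => latency_nonneg
  have hmean : ∫⁻ ω, ENNReal.ofReal (L ω) ∂ν =
      ENNReal.ofReal (meanTime n₁ n₂ k₁ k₂ μ₁ μ₂ 0 0) :=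
    (hlaw.lintegral_comp measurable_latency.ennreal_ofReal.aemeasurable).trans
      (lintegral_latency hk₁ hkn₁ hkn₂ hμ₁ hμ₂)
  have hint : Integrable L ν :=
    (lintegral_ofReal_ne_top_iff_integrable hmeas.aestronglyMeasurable hnonneg).1
      (hmean ▸ ENNReal.ofReal_ne_top)
  refine ⟨hint, (measurable_hittingTime (fun t => hX.measurableSet_mem t _)
    hX.rightContinuous).aemeasurable, ?_⟩
  rw [ofReal_integral_eq_lintegral_ofReal hint hnonneg, hmean]
  exact lintegral_hittingTime_target hk₁ hkn₁ hkn₂ hμ₁ hμ₂ hX
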